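/- **Setting.** A DC microgrid is a connected undirected simple graph whose $n$ nodes are partitioned into a nonempty finite set $\mathcal V_s$ of $n_s$ sources and a nonempty finite set $\mathcal V_l$ of $n_l$ loads; its edges carry resistances $r_k>0$. Let $B$ be an oriented incidence matrix, $\Gamma=\mathrm{diag}(r_k^{-1})$ and $$Y=B\Gamma B^T=\begin{bmatrix}Y_{ss}&Y_{sl}\\Y_{ls}&Y_{ll}\end{bmatrix}.$$ Let $L_c$ be the Laplacian of a connected undirected unweighted communication graph on $\mathcal V_s$ and $C_s=\mathrm{diag}(C_i)$ with $C_i>0$. For a vector $v$, $[v]$ is the diagonal matrix with diagonal $v$, and $\mathbb 1$ is the all-ones vector. The loads are ZI loads, $I_l(V_l)=I_l^*-Y_l^*V_l$, where $I_l^*\le 0$ entrywise, $Y_l^*\ge 0$ is diagonal, and at every load the constant current or the conductance is nonzero. With $V=\mathrm{col}(V_s,V_l)\in\mathbb R^n$ and $P_s=P_s(V)=[V_s](Y_{ss}V_s+Y_{sl}V_l)$, the closed-loop system is $$C_s\dot V_s=-[V_s]L_cC_s^{-1}P_s,\qquad I_l(V_l)=Y_{ls}V_s+Y_{ll}V_l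 .\tag{1}$$ Let $\mathcal E_{ZI}$ be the set of $V\in\mathbb R^n_{>0}$ with $V_l=(Y_{ll}+Y_l^*)^{-1}(I_l^*-Y_{ls}V_s)$ and $$[V_s]\hat Y_{red}V_s+[V_s]Y_{sl}(Y_{ll}+Y_l^*)^{-1}I_l^*-C_s\mathbb 1p_s^*=0,$$ where $\hat Y_{red}=Y_{ss}-Y_{sl}(Y_{ll}+Y_l^*)^{-1}Y_{ls}$ and $$p_s^*=-\frac{\mathbb 1^T\big(I_l^*-Y_l^*(Y_{ll}+Y_l^*)^{-1}(I_l^*-Y_{ls}V_s)\big)}{\mathbb 1^T[V_s]^{-1}C_s\mathbb 1}.$$ Assume $\mathcal E_{ZI}\neq\emptyset$, fix $\overline V\in\mathcal E_{ZI}$, put $\overline P_s=P_s(\overline V)$, and for $V_s>0$ let $$M(V)=\tfrac12V^T\Big(Y+\begin{bmatrix}0&0\\0&Y_l^*\end{bmatrix}\Big)V-\sum_{i\in\mathcal V_s}\overline P_{s,i}\ln V_i,\qquad \mathcal M(V)=M(V)-M(\overline V)-\nabla M(\overline V)^T(V-\overline V).$$ For $c\in\mathbb R$ let $\Lambda_c=\{V\in\mathbb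 R^n: V_s>0,\ \mathcal M(V)\le c\}$. **Theorem.** There is $c>0$ such that $\Lambda_c$ is compact and contained in $\mathbb R^n_{>0}$. Moreover, let $\Lambda_{ZI}=\Lambda_c$ be any sublevel set of $\mathcal M$ with $\Lambda_{ZI}\subset\mathbb R^n_{>0}$, and let $V(0)\in\Lambda_{ZI}$ satisfy the load equation in (1). Then the solution of (1) starting at $V(0)$ exists on $[0,\infty)$ and is unique, it remains in $\Lambda_{ZI}$ for all $t\ge 0$, and it converges as $t\to\infty$ to a single point $V^\infty\in\mathcal E_{ZI}\cap\Lambda_{ZI}\cap\mathcal V_{ZI}$ (depending on $V(0)$), where $$\mathcal V_{ZI}=\Big\{V\in\Lambda_{ZI}:\ \prod_{i\in\mathcal V_s}V_i^{C_i}=\prod_{i\in\mathcal V_s}V_i(0)^{C_i},\ V_l=(Y_{ll}+Y_l^*)^{-1}(I_l^*-Y_{ls}V_s)\Big\}.$$ The point $V^\infty$ is an equilibrium of (1) that is asymptotically stable in the following sense: it is Lyapunov stable with respect to all solutions of (1), and it attracts every solution of (1) on $[0,\infty)$ that starts sufficiently close to it with the same value of the conserved weighted geometric mean, i.e. with $\prod_{i\in\mathcal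 V_s}V_i(0)^{C_i}=\prod_{i\in\mathcal V_s}(V_i^\infty)^{C_i}$. -/

import Mathlib

open Set Filter Topology
open scoped Matrix

/-- A DC resistive microgrid with source buses `S`, load buses `L` and ZI loads, together with the
communication graph and the weights of the power consensus controllers. -/
structure Microgrid (S L : Type*) where
  /-- the electrical network: nodes are the buses, edges are the lines -/
  graph : SimpleGraph (S ⊕ L)
  graph_connected : graph.Connected
  /-- an arbitrary orientation of the lines, used to write the incidence matrix -/
  tail : graph.edgeSet → S ⊕ L
  head : graph.edgeSet → S ⊕ L
  orientation : ∀ e : graph.edgeSet, s(tail e, head e) = (e : Sym2 (S ⊕ L))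
  /-- line resistances -/
  r : graph.edgeSet → ℝ
  r_pos : ∀ e, 0 < r e
  /-- the (undirected, unweighted) communication graph of the sources -/
  comm : SimpleGraph S
  comm_connected : comm.Connected
  /-- controller parameters -/
  C : S → ℝ
  C_pos : ∀ i, 0 < C i
  /-- constant load currents `I_l^*` -/
  Il : L → ℝ
  /-- load conductances, the diagonal of `Y_l^*` -/
  Yl : L → ℝ
  Il_nonpos : ∀ j, Il j ≤ 0
  Yl_nonneg : ∀ j, 0 ≤ Yl j
  load_nonzero : ∀ j, Il j < 0 ∨ 0 < Yl j

namespace Microgrid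

noncomputable section

variable {S L : Type*} [Fintype S] [Fintype L] [DecidableEq S] [DecidableEq L]
  (N : Microgrid S L)

/-- Oriented incidence matrix `B`. -/
def B : Matrix (S ⊕ L) N.graph.edgeSet ℝ := fun i e =>
  (if i = N.tail e then 1 else 0) - (if i = N.head e then 1 else 0)

open Classical in
/-- The conductance matrix `Y = B Γ Bᵀ`, where `Γ = diag (1 / r)`. -/
def Y : Matrix (S ⊕ L) (S ⊕ L) ℝ :=
  N.B * Matrix.diagonal (fun e => (N.r e)⁻¹) * N.Bᵀ

def Yss : Matrix S S ℝ := N.Y.toBlocks₁₁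
def Ysl : Matrix S L ℝ := N.Y.toBlocks₁₂
def Yls : Matrix L S ℝ := N.Y.toBlocks₂₁
def Yll : Matrix L L ℝ := N.Y.toBlocks₂₂

/-- The diagonal matrix `Y_l^*` of load conductances. -/
def YlMat : Matrix L L ℝ := Matrix.diagonal N.Yl

open Classical in
/-- Laplacian `L_c` of the communication graph. -/
def Lc : Matrix S S ℝ := N.comm.lapMatrix ℝ

/-- The open positive orthant `ℝⁿ_{>0}`. -/
def posOrthant (S L : Type*) : Set (S ⊕ L → ℝ) := {V | ∀ k, 0 < V k}

/-- Source voltages of `V = col (V_s, V_l)`. -/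
def src (V : S ⊕ L → ℝ) : S → ℝ := fun i => V (Sum.inl i)

/-- Load voltages of `V = col (V_s, V_l)`. -/
def ld (V : S ⊕ L → ℝ) : L → ℝ := fun j => V (Sum.inr j)

/-- Source power injections `P_s = [V_s] (Y_ss V_s + Y_sl V_l)`. -/
def Ps (V : S ⊕ L → ℝ) : S → ℝ := fun i =>
  src V i * (N.Yss *ᵥ src V + N.Ysl *ᵥ ld V) i

/-- ZI load currents `I_l(V_l) = I_l^* - Y_l^* V_l`. -/
def loadCurrent (Vl : L → ℝ) : L → ℝ := N.Il - N.YlMat *ᵥ Vl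

/-- The algebraic equation at the loads, `I_l(V_l) = B_l Γ Bᵀ V = Y_ls V_s + Y_ll V_l`. -/
def LoadBalance (V : S ⊕ L → ℝ) : Prop :=
  N.loadCurrent (ld V) = N.Yls *ᵥ src V + N.Yll *ᵥ ld V

/-- The right-hand side `-[V_s] L_c C_s⁻¹ P_s` of the source dynamics. -/
def sourceRHS (V : S ⊕ L → ℝ) : S → ℝ := fun i =>
  -(src V i * (N.Lc *ᵥ fun k => (N.C k)⁻¹ * N.Ps V k) i)

/-- `V` solves the closed-loop differential-algebraic system on the time interval `J`:
`C_s V̇_s = -[V_s] L_c C_s⁻¹ P_s` together with the load equation. -/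
structure IsSolution (J : Set ℝ) (V : ℝ → S ⊕ L → ℝ) : Prop where
  source : ∀ t ∈ J, ∀ i : S,
    HasDerivWithinAt (fun τ => N.C i * src (V τ) i) (N.sourceRHS (V t) i) J t
  load : ∀ t ∈ J, N.LoadBalance (V t)

/-- Equilibrium of the closed-loop system. -/
def IsEquilibrium (V : S ⊕ L → ℝ) : Prop :=
  V ∈ posOrthant S L ∧ N.sourceRHS V = 0 ∧ N.LoadBalance V

/-- `(Y_ll + Y_l^*)⁻¹ (I_l^* - Y_ls V_s)`. -/
def loadVoltage (Vs : S → ℝ) : L → ℝ :=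
  (N.Yll + N.YlMat)⁻¹ *ᵥ (N.Il - N.Yls *ᵥ Vs)

/-- Kron-reduced conductance matrix absorbing the impedance loads. -/
def YredHat : Matrix S S ℝ := N.Yss - N.Ysl * (N.Yll + N.YlMat)⁻¹ * N.Yls

/-- The scalar `p_s^*`: minus the total load current over `𝟙ᵀ [V_s]⁻¹ C_s 𝟙`. -/
def psStar (Vs : S → ℝ) : ℝ :=
  -(∑ j, (N.Il - N.YlMat *ᵥ N.loadVoltage Vs) j) / ∑ i, (Vs i)⁻¹ * N.C i

/-- Power balance at the sources. -/
def powerBalance (Vs : S → ℝ) : S → ℝ := fun i =>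
  Vs i * (N.YredHat *ᵥ Vs) i + Vs i * (N.Ysl *ᵥ ((N.Yll + N.YlMat)⁻¹ *ᵥ N.Il)) i
    - N.C i * N.psStar Vs

/-- The set `𝓔_ZI`. -/
def equilibria : Set (S ⊕ L → ℝ) :=
  {V | V ∈ posOrthant S L ∧ N.powerBalance (src V) = 0 ∧ ld V = N.loadVoltage (src V)}

/-- Power losses at passive devices, `J(V) = ½ Vᵀ (B Γ Bᵀ + diag (0, Y_l^*)) V`. -/
def losses (V : S ⊕ L → ℝ) : ℝ :=
  (1 / 2) * (V ⬝ᵥ ((N.Y + Matrix.fromBlocks 0 0 0 N.YlMat) *ᵥ V))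

/-- The energy function `M(V) = J(V) - P̄_sᵀ ln V_s`, with `P̄_s` the source powers at `Vbar`. -/
def energy (Vbar V : S ⊕ L → ℝ) : ℝ :=
  N.losses V - ∑ i, N.Ps Vbar i * Real.log (src V i)

/-- The shifted (Bregman) function `𝓜`, centred at `Vbar`. -/
def bregman (Vbar V : S ⊕ L → ℝ) : ℝ :=
  N.energy Vbar V - N.energy Vbar Vbar - fderiv ℝ (N.energy Vbar) Vbar (V - Vbar)

/-- The sublevel set of `𝓜` at level `c`. The function `𝓜` contains the logarithms of the source
voltages only, so its domain is `V_s > 0`; the load voltages are not restricted here. -/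
def sublevel (Vbar : S ⊕ L → ℝ) (c : ℝ) : Set (S ⊕ L → ℝ) :=
  {V | (∀ i, 0 < src V i) ∧ N.bregman Vbar V ≤ c}

/-- States with the same weighted geometric mean of the source voltages as `V0`. -/
def leaf (V0 : S ⊕ L → ℝ) : Set (S ⊕ L → ℝ) :=
  {V | ∏ i, src V i ^ N.C i = ∏ i, src V0 i ^ N.C i}

/-- The set `𝓥_ZI` (within a given sublevel set `Λ`) attached to the initial condition `V0`. -/
def preserved (Λ : Set (S ⊕ L → ℝ)) (V0 : S ⊕ L → ℝ) : Set (S ⊕ L → ℝ) :=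
  {V | V ∈ Λ ∧ V ∈ N.leaf V0 ∧ ld V = N.loadVoltage (src V)}

/-- Lyapunov stability, with respect to all solutions of the closed-loop system. -/
def LyapunovStable (Ve : S ⊕ L → ℝ) : Prop :=
  ∀ ε > 0, ∃ δ > 0, ∀ (T : ℝ) (V : ℝ → S ⊕ L → ℝ), N.IsSolution (Ico 0 T) V →
    dist (V 0) Ve < δ → ∀ t ∈ Ico 0 T, dist (V t) Ve < ε

/-- `Ve` is an equilibrium that is Lyapunov stable (with respect to all solutions) and attracts
every solution that starts close to it with the same weighted geometric mean of the source
voltages. That mean is a conserved quantity, so no equilibrium attracts a full neighbourhood. -/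
def AsymptoticallyStable (Ve : S ⊕ L → ℝ) : Prop :=
  N.IsEquilibrium Ve ∧ N.LyapunovStable Ve ∧
    ∃ δ > 0, ∀ V : ℝ → S ⊕ L → ℝ, N.IsSolution (Ici 0) V →
      V 0 ∈ N.leaf Ve → dist (V 0) Ve < δ → Tendsto V atTop (𝓝 Ve)

end

end Microgrid

/-!
In the coordinates `u = log V_s` the closed loop is a smooth ODE on all of `ℝ^S`. Along it the
derivative of `𝓜` is `-zᵀ L_c z` with `z = C_s⁻¹ P_s`, and `𝓜` splits into a positive semidefinite
quadratic form of the losses and Itakura–Saito divergences of the source voltages, so its sublevel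
sets are compact. Hence solutions are global, and LaSalle's argument yields a limit point where `z`
is constant, which is a point of `𝓔_ZI`. The Bregman function recentred at that limit point is again
a Lyapunov function, now with its strict minimum there, so the whole trajectory converges. The limit
attracts its leaf because two equilibria `V`, `W` on one leaf coincide: there `P_s` is proportional
to `C_s 𝟙`, which makes the loss form of `V - W` minus a positive combination of Itakura–Saito
divergences.
-/

section AutonomousODE

variable {E : Type*} [NormedAddCommGroup E] [NormedSpace ℝ E] {f : E → E} {m : E → ℝ} {u w : ℝ → E}

theorem exists_isIntegralCurve_of_hasCompactSupport [CompleteSpace E] (hf : ContDiff ℝ 1 f)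
    (hsupp : HasCompactSupport f) (x₀ : E) :
    ∃ u : ℝ → E, u 0 = x₀ ∧ IsIntegralCurve u fun _ ↦ f := by
  obtain ⟨K, hK⟩ := hf.lipschitzWith_of_hasCompactSupport hsupp one_ne_zero
  obtain ⟨M, hM⟩ := hsupp.exists_bound_of_continuous hf.continuous
  have hlocal (x : E) : ∃ γ : ℝ → E, γ 0 = x ∧
      IsMIntegralCurveOn (I := modelWithCornersSelf ℝ E) γ f (Ioo (-1) 1) := by
    have hPL : IsPicardLindelof (fun _ ↦ f) (tmin := -1) (tmax := 1) ⟨0, by simp⟩ x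
        M.toNNReal 0 M.toNNReal K :=
      { lipschitzOnWith := fun _ _ ↦ hK.lipschitzOnWith
        continuousOn := fun _ _ ↦ continuousOn_const
        norm_le := fun _ _ y _ ↦ (hM y).trans (Real.le_coe_toNNReal M)
        mul_max_le := by simp }
    obtain ⟨γ, hγ0, hγ⟩ := hPL.exists_eq_forall_mem_Icc_hasDerivWithinAt₀
    exact ⟨γ, hγ0, fun t ht ↦ HasFDerivWithinAt.hasMFDerivWithinAt <|
      ((hγ t (Ioo_subset_Icc_self ht)).mono Ioo_subset_Icc_self).hasFDerivWithinAt⟩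
  obtain ⟨u, hu0, hu⟩ := exists_isMIntegralCurve_of_isMIntegralCurveOn
    (contMDiff_vectorSpace_iff_contDiff.2 hf) one_pos hlocal x₀
  exact ⟨u, hu0, fun t ↦ hasDerivAt_iff_hasFDerivAt.2 (hu t).hasFDerivAt⟩

theorem antitoneOn_comp_of_isIntegralCurveOn {J : Set ℝ} (hJ : Convex ℝ J)
    (hm : Differentiable ℝ m) (hle : ∀ x, fderiv ℝ m x (f x) ≤ 0)
    (hu : IsIntegralCurveOn u (fun _ ↦ f) J) : AntitoneOn (m ∘ u) J := by
  have hderiv : ∀ t ∈ J, HasDerivWithinAt (m ∘ u) (fderiv ℝ m (u t) (f (u t))) J t :=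
    fun t ht ↦ (hm (u t)).hasFDerivAt.comp_hasDerivWithinAt t (hu t ht)
  exact antitoneOn_of_hasDerivWithinAt_nonpos hJ (fun t ht ↦ (hderiv t ht).continuousWithinAt)
    (fun t ht ↦ (hderiv t (interior_subset ht)).mono interior_subset) fun t _ ↦ hle (u t)

theorem exists_isIntegralCurveOn_Ici_of_isCompact_sublevel [FiniteDimensional ℝ E]
    (hf : ContDiff ℝ 1 f) (hm : Differentiable ℝ m) (hle : ∀ x, fderiv ℝ m x (f x) ≤ 0) {x₀ : E}
    (hK : IsCompact {x | m x ≤ m x₀}) :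
    ∃ u : ℝ → E, u 0 = x₀ ∧ IsIntegralCurveOn u (fun _ ↦ f) (Ici 0) := by
  obtain ⟨R, hR0, hR⟩ := hK.isBounded.subset_closedBall_lt 0 (0 : E)
  -- Cutting `f` off outside the sublevel set makes it complete, and `m` still decreases along it.
  let χ : ContDiffBump (0 : E) := ⟨R, R + 1, hR0, lt_add_one R⟩
  obtain ⟨u, hu0, hu⟩ := exists_isIntegralCurve_of_hasCompactSupport (χ.contDiff.smul hf)
    χ.hasCompactSupport.smul_right x₀
  have hanti : AntitoneOn (m ∘ u) (Ici 0) :=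
    antitoneOn_comp_of_isIntegralCurveOn (convex_Ici 0) hm
      (fun x ↦ by simpa using mul_nonpos_of_nonneg_of_nonpos χ.nonneg (hle x))
      (hu.isIntegralCurveOn _)
  refine ⟨u, hu0, fun t ht ↦ ?_⟩
  have hmem : u t ∈ {x | m x ≤ m x₀} := by simpa [hu0] using hanti self_mem_Ici ht ht
  simpa [χ.one_of_mem_closedBall (hR hmem)] using (hu t).hasDerivWithinAt (s := Ici 0)

theorem exists_seq_tendsto_deriv_zero_of_bounded {g g' : ℝ → ℝ} {b : ℝ}
    (hg : ∀ t ∈ Ici 0, HasDerivWithinAt g (g' t) (Ici 0) t) (hb : ∀ t ∈ Ici 0, |g t| ≤ b) :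
    ∃ s : ℕ → ℝ, Tendsto s atTop atTop ∧ Tendsto (g' ∘ s) atTop (𝓝 0) := by
  have hslope (n : ℕ) : ∃ s : ℝ, n ≤ s ∧ |g' s| ≤ 2 * b / (n + 1) := by
    have hn : (0 : ℝ) ≤ n := n.cast_nonneg
    obtain ⟨s, hs, hslope⟩ := exists_hasDerivAt_eq_slope g g' (a := n) (b := n + (n + 1))
      (by linarith)
      (fun t ht ↦ (hg t (hn.trans ht.1)).continuousWithinAt.mono fun r hr ↦ hn.trans hr.1)
      (fun t ht ↦ (hg t (hn.trans ht.1.le)).hasDerivAt (Ici_mem_nhds (hn.trans_lt ht.1)))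
    refine ⟨s, hs.1.le, ?_⟩
    rw [hslope, add_sub_cancel_left, abs_div, abs_of_pos (by positivity : (0 : ℝ) < n + 1)]
    gcongr
    linarith [abs_sub (g (n + (n + 1))) (g n), hb n hn, hb (n + (n + 1)) (mem_Ici.2 (by linarith))]
  choose s hs hg's using hslope
  exact ⟨s, tendsto_atTop_mono hs tendsto_natCast_atTop_atTop,
    squeeze_zero_norm hg's <| tendsto_const_nhds.div_atTop <|
      tendsto_atTop_add_const_right _ _ tendsto_natCast_atTop_atTop⟩

theorem exists_mapClusterPt_fderiv_apply_eq_zero (hm : Differentiable ℝ m)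
    (hcont : Continuous fun x ↦ fderiv ℝ m x (f x)) (hu : IsIntegralCurveOn u (fun _ ↦ f) (Ici 0))
    {K : Set E} (hK : IsCompact K) (huK : MapsTo u (Ici 0) K) :
    ∃ x ∈ K, fderiv ℝ m x (f x) = 0 ∧ MapClusterPt x atTop u := by
  obtain ⟨b, hb⟩ := hK.exists_bound_of_continuousOn hm.continuous.continuousOn
  obtain ⟨s, hs, hs0⟩ := exists_seq_tendsto_deriv_zero_of_bounded
    (fun t ht ↦ (hm (u t)).hasFDerivAt.comp_hasDerivWithinAt t (hu t ht))
    (fun t ht ↦ hb _ (huK ht))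
  obtain ⟨x, hxK, φ, hφ, hlim⟩ := hK.tendsto_subseq' (x := u ∘ s)
    ((hs.eventually_ge_atTop 0).mono fun n hn ↦ huK hn).frequently
  exact ⟨x, hxK, tendsto_nhds_unique ((hcont.tendsto x).comp hlim) (hs0.comp hφ.tendsto_atTop),
    hlim.mapClusterPt.of_comp (hs.comp hφ.tendsto_atTop)⟩

theorem eqOn_Ico_of_isIntegralCurveOn (hf : LocallyLipschitz f) {a b : ℝ}
    (hu : IsIntegralCurveOn u (fun _ ↦ f) (Ico a b))
    (hw : IsIntegralCurveOn w (fun _ ↦ f) (Ico a b)) (ha : u a = w a) : EqOn u w (Ico a b) := by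
  intro T hT
  have hsub : Icc a T ⊆ Ico a b := Icc_subset_Ico_right hT.2
  have hright {v : ℝ → E} (hv : IsIntegralCurveOn v (fun _ ↦ f) (Ico a b)) :
      ∀ t ∈ Ico a T, HasDerivWithinAt v (f (v t)) (Ici t) t := fun t ht ↦
    (hv t (hsub (Ico_subset_Icc_self ht))).mono_of_mem_nhdsWithin <|
      mem_of_superset (Ico_mem_nhdsGE (ht.2.trans hT.2)) (Ico_subset_Ico_left ht.1)
  have huc := hu.continuousOn.mono hsub
  have hwc := hw.continuousOn.mono hsub
  obtain ⟨K, hK⟩ := (hf.locallyLipschitzOn (s := u '' Icc a T ∪ w '' Icc a T))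
    |>.exists_lipschitzOnWith_of_compact
      ((isCompact_Icc.image_of_continuousOn huc).union (isCompact_Icc.image_of_continuousOn hwc))
  exact ODE_solution_unique_of_mem_Icc_right (fun _ _ ↦ hK)
    huc (hright hu) (fun t ht ↦ .inl (mem_image_of_mem u (Ico_subset_Icc_self ht)))
    hwc (hright hw) (fun t ht ↦ .inr (mem_image_of_mem w (Ico_subset_Icc_self ht))) ha
    (right_mem_Icc.2 hT.1)

end AutonomousODE

theorem tendsto_of_mapClusterPt_of_stable {X ι : Type*} [TopologicalSpace X] [Preorder ι]
    [IsDirectedOrder ι] [Nonempty ι] {u : ι → X} {x : X} (hx : MapClusterPt x atTop u)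
    (hstable : ∀ U ∈ 𝓝 x, ∃ W ∈ 𝓝 x, ∀ᶠ s in atTop, u s ∈ W → ∀ t ≥ s, u t ∈ U) :
    Tendsto u atTop (𝓝 x) := by
  intro U hU
  obtain ⟨W, hW, hWU⟩ := hstable U hU
  obtain ⟨s, hsW, hsU⟩ := ((hx.frequently hW).and_eventually hWU).exists
  exact mem_map.2 (mem_of_superset (Ici_mem_atTop s) (hsU hsW))

section QuadraticForm

variable {n : Type*} [Fintype n]

theorem dotProduct_mulVec_comm_of_isSymm {R : Type*} [CommSemiring R] {A : Matrix n n R}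
    (hA : A.IsSymm) (x y : n → R) : x ⬝ᵥ A *ᵥ y = y ⬝ᵥ A *ᵥ x := by
  simpa only [hA.eq] using Matrix.dotProduct_transpose_mulVec A x y

theorem sum_mulVec_eq_zero_of_isSymm {R : Type*} [CommSemiring R] {A : Matrix n n R}
    (hA : A.IsSymm) (hA₁ : A *ᵥ 1 = 0) (x : n → R) : ∑ i, (A *ᵥ x) i = 0 := by
  rw [← one_dotProduct, dotProduct_mulVec_comm_of_isSymm hA, hA₁, dotProduct_zero]

open scoped MatrixOrder in
theorem isBounded_setOf_dotProduct_mulVec_le {A : Matrix n n ℝ} (hA : A.PosDef) (c : ℝ) :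
    Bornology.IsBounded {x | x ⬝ᵥ A *ᵥ x ≤ c} := by
  classical
  obtain ⟨B, rfl⟩ := CStarAlgebra.nonneg_iff_eq_star_mul_self.1 hA.posSemidef.nonneg
  have hsq (x : n → ℝ) : x ⬝ᵥ (star B * B) *ᵥ x = ∑ i, (B *ᵥ x) i ^ 2 := by
    rw [← Matrix.mulVec_mulVec, Matrix.star_eq_conjTranspose,
      Matrix.conjTranspose_eq_transpose_of_trivial, Matrix.dotProduct_transpose_mulVec]
    simp only [dotProduct, sq]
  have hker : LinearMap.ker B.mulVecLin = ⊥ := by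
    refine LinearMap.ker_eq_bot'.2 fun x hx ↦ ?_
    by_contra hx0
    have hpos := hA.dotProduct_mulVec_pos hx0
    rw [star_trivial, hsq] at hpos
    simp [show B *ᵥ x = 0 from hx] at hpos
  obtain ⟨K, -, hK⟩ := B.mulVecLin.exists_antilipschitzWith hker
  refine (hK.isBounded_preimage (Metric.isBounded_closedBall (x := 0) (r := √c))).subset
    fun x hx ↦ ?_
  rw [mem_preimage, mem_closedBall_zero_iff, pi_norm_le_iff_of_nonneg (Real.sqrt_nonneg c)]
  refine fun i ↦ Real.abs_le_sqrt ?_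
  exact (Finset.single_le_sum (fun j _ ↦ sq_nonneg ((B *ᵥ x) j)) (Finset.mem_univ i)).trans
    ((hsq x).symm.le.trans hx)

theorem hasFDerivAt_half_dotProduct_mulVec {A : Matrix n n ℝ} (hA : A.IsSymm) (x : n → ℝ) :
    HasFDerivAt (fun y ↦ 1 / 2 * (y ⬝ᵥ A *ᵥ y))
      (∑ k, (A *ᵥ x) k • ContinuousLinearMap.proj (R := ℝ) (φ := fun _ : n ↦ ℝ) k) x := by
  have hmul (k : n) : HasFDerivAt (fun y ↦ y k * (A *ᵥ y) k) _ x :=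
    (hasFDerivAt_apply k x).mul
      (hasFDerivAt_pi'.1 (A.mulVecLin.toContinuousLinearMap.hasFDerivAt (x := x)) k)
  refine ((HasFDerivAt.fun_sum fun k _ ↦ hmul k).const_mul (1 / 2)).congr_fderiv ?_
  ext v
  have hcomm := dotProduct_mulVec_comm_of_isSymm hA x v
  simp only [dotProduct] at hcomm
  simp only [Finset.sum_add_distrib, smul_add, add_apply, smul_apply, sum_apply,
    ContinuousLinearMap.comp_apply, LinearMap.coe_toContinuousLinearMap', Matrix.mulVecBilin_apply,
    ContinuousLinearMap.proj_apply, smul_eq_mul, hcomm, mul_comm]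
  ring

end QuadraticForm

section ItakuraSaito

/-- The Itakura–Saito divergence `x / y - log (x / y) - 1` of positive reals, i.e. the Bregman
divergence of `-log`. The source voltages enter `bregman` only through it and the power losses. -/
noncomputable def itakuraSaito (x y : ℝ) : ℝ := x / y - Real.log (x / y) - 1

variable {x y k : ℝ}

theorem itakuraSaito_nonneg (hx : 0 < x) (hy : 0 < y) : 0 ≤ itakuraSaito x y := by
  unfold itakuraSaito
  linarith [Real.log_le_sub_one_of_pos (div_pos hx hy)]

theorem itakuraSaito_eq_zero_iff (hx : 0 < x) (hy : 0 < y) : itakuraSaito x y = 0 ↔ x = y := by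
  refine ⟨fun h ↦ ?_, fun h ↦ by simp [itakuraSaito, h, hy.ne']⟩
  rw [← div_eq_one_iff_eq hy.ne']
  by_contra hne
  unfold itakuraSaito at h
  linarith [Real.log_lt_sub_one_of_pos (div_pos hx hy) hne]

theorem abs_log_div_le_of_itakuraSaito_le (hx : 0 < x) (hy : 0 < y) (h : itakuraSaito x y ≤ k) :
    |Real.log (x / y)| ≤ k + 1 := by
  have hexp : Real.exp (Real.log (x / y)) = x / y := Real.exp_log (div_pos hx hy)
  unfold itakuraSaito at h
  rw [← hexp] at h
  simp only [Real.log_exp] at h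
  generalize Real.log (x / y) = z at h ⊢
  rcases le_total 0 z with hz | hz
  · rw [abs_of_nonneg hz]
    nlinarith [Real.quadratic_le_exp_of_nonneg hz, sq_nonneg (z - 1)]
  · rw [abs_of_nonpos hz]
    linarith [Real.exp_pos z]

theorem mem_Icc_of_itakuraSaito_le (hx : 0 < x) (hy : 0 < y) (h : itakuraSaito x y ≤ k) :
    x ∈ Icc (y * Real.exp (-(k + 1))) (y * Real.exp (k + 1)) := by
  have hlog := abs_le.1 (abs_log_div_le_of_itakuraSaito_le hx hy h)
  rw [Real.le_log_iff_exp_le (div_pos hx hy), Real.log_le_iff_le_exp (div_pos hx hy),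
    le_div_iff₀' hy, div_le_iff₀' hy] at hlog
  exact hlog

end ItakuraSaito

namespace Microgrid

noncomputable section

section Network

variable {S L : Type*} [Fintype S] [Fintype L] [DecidableEq S] [DecidableEq L]
  (N : Microgrid S L)

theorem posSemidef_Y : N.Y.PosSemidef := by
  classical
  rw [Y, ← Matrix.conjTranspose_eq_transpose_of_trivial]
  exact (Matrix.PosSemidef.diagonal fun e ↦
    inv_nonneg.2 (N.r_pos e).le).mul_mul_conjTranspose_same N.B

theorem isSymm_Y : N.Y.IsSymm := by
  simpa only [Matrix.conjTranspose_eq_transpose_of_trivial] using! N.posSemidef_Y.isHermitian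

theorem transpose_B_mulVec_apply (x : S ⊕ L → ℝ) (e : N.graph.edgeSet) :
    (N.Bᵀ *ᵥ x) e = x (N.tail e) - x (N.head e) := by
  simp [Matrix.mulVec, dotProduct, B, sub_mul, Finset.sum_sub_distrib]

theorem transpose_B_mulVec_eq_zero_iff {x : S ⊕ L → ℝ} :
    N.Bᵀ *ᵥ x = 0 ↔ ∀ k l, x k = x l := by
  refine ⟨fun hx k l ↦ ?_, fun hx ↦ funext fun e ↦ ?_⟩
  · have hadj : ∀ ⦃k l⦄, N.graph.Adj k l → x k = x l := by
      intro k l hkl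
      have hdiff : x (N.tail ⟨s(k, l), hkl⟩) = x (N.head ⟨s(k, l), hkl⟩) :=
        sub_eq_zero.1 ((N.transpose_B_mulVec_apply x _).symm.trans (congrFun hx _))
      obtain ⟨ht, hh⟩ | ⟨ht, hh⟩ := Sym2.eq_iff.1 (N.orientation ⟨s(k, l), hkl⟩)
      · rwa [ht, hh] at hdiff
      · rw [ht, hh] at hdiff
        exact hdiff.symm
    obtain ⟨path⟩ := N.graph_connected.preconnected k l
    induction path with
    | nil => rfl
    | cons h _ ih => exact (hadj h).trans ih
  · rw [transpose_B_mulVec_apply, hx _ (N.head e), sub_self, Pi.zero_apply]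

theorem Y_mulVec_eq_zero_iff {x : S ⊕ L → ℝ} : N.Y *ᵥ x = 0 ↔ ∀ k l, x k = x l := by
  classical
  rw [← transpose_B_mulVec_eq_zero_iff, Y, ← Matrix.mulVec_mulVec, ← Matrix.mulVec_mulVec]
  refine ⟨fun hx ↦ ?_, fun hx ↦ by rw [hx, Matrix.mulVec_zero, Matrix.mulVec_zero]⟩
  have hzero := congrArg (x ⬝ᵥ ·) hx
  simp only [dotProduct_zero] at hzero
  rw [← Matrix.transpose_transpose N.B, Matrix.dotProduct_transpose_mulVec,
    Matrix.transpose_transpose, dotProduct_comm] at hzero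
  by_contra hne
  exact ((Matrix.PosDef.diagonal fun e ↦ inv_pos.2 (N.r_pos e)).dotProduct_mulVec_pos hne).ne'
    hzero

theorem sum_Y_mulVec (x : S ⊕ L → ℝ) : ∑ k, (N.Y *ᵥ x) k = 0 :=
  sum_mulVec_eq_zero_of_isSymm N.isSymm_Y (N.Y_mulVec_eq_zero_iff.2 fun _ _ ↦ rfl) x

theorem posDef_Y_add_diagonal {d : S ⊕ L → ℝ} (hd : 0 ≤ d) {k : S ⊕ L} (hk : 0 < d k) :
    (N.Y + Matrix.diagonal d).PosDef := by
  have hdiag : (Matrix.diagonal d).PosSemidef := .diagonal hd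
  refine .of_dotProduct_mulVec_pos (N.posSemidef_Y.add hdiag).isHermitian fun x hx ↦ ?_
  have hYx := N.posSemidef_Y.dotProduct_mulVec_nonneg x
  have hdx := hdiag.dotProduct_mulVec_nonneg x
  rw [Matrix.add_mulVec, dotProduct_add]
  refine (add_nonneg hYx hdx).lt_of_ne' fun hsum ↦ hx (funext fun l ↦ ?_)
  obtain ⟨hYx, hdx⟩ := (add_eq_zero_iff_of_nonneg hYx hdx).1 hsum
  rw [N.posSemidef_Y.dotProduct_mulVec_zero_iff, Y_mulVec_eq_zero_iff] at hYx
  rw [hdiag.dotProduct_mulVec_zero_iff] at hdx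
  have hxk : d k * x k = 0 := by rw [← Matrix.mulVec_diagonal, hdx, Pi.zero_apply]
  exact (hYx l k).trans ((mul_eq_zero.1 hxk).resolve_left hk.ne')

theorem posDef_Y_add_diagonal_elim_one : (N.Y + Matrix.diagonal (Sum.elim 1 N.Yl)).PosDef := by
  obtain ⟨i⟩ := N.comm_connected.nonempty
  refine N.posDef_Y_add_diagonal ?_ (k := Sum.inl i) one_pos
  rintro (i | j)
  · exact zero_le_one
  · exact N.Yl_nonneg j

theorem posDef_Yll_add_YlMat : (N.Yll + N.YlMat).PosDef := by
  have heq : N.Yll + N.YlMat =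
      (N.Y + Matrix.diagonal (Sum.elim 1 N.Yl)).submatrix Sum.inr Sum.inr := by
    ext j k
    simp [Yll, YlMat, Matrix.toBlocks₂₂, Matrix.diagonal_apply]
  rw [heq]
  exact N.posDef_Y_add_diagonal_elim_one.submatrix Sum.inr_injective

/-- The matrix `Y + diag (0, Y_l^*)` of the power losses, i.e. the Hessian of `losses`. -/
def lossMatrix : Matrix (S ⊕ L) (S ⊕ L) ℝ := N.Y + Matrix.fromBlocks 0 0 0 N.YlMat

theorem lossMatrix_eq_Y_add_diagonal :
    N.lossMatrix = N.Y + Matrix.diagonal (Sum.elim 0 N.Yl) := by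
  rw [lossMatrix, YlMat, ← Matrix.fromBlocks_diagonal, Pi.zero_def, Matrix.diagonal_zero]

theorem posSemidef_lossMatrix : N.lossMatrix.PosSemidef := by
  rw [lossMatrix_eq_Y_add_diagonal]
  refine N.posSemidef_Y.add (.diagonal ?_)
  rintro (i | j)
  · exact le_rfl
  · exact N.Yl_nonneg j

theorem isSymm_lossMatrix : N.lossMatrix.IsSymm := by
  simpa only [Matrix.conjTranspose_eq_transpose_of_trivial] using!
    N.posSemidef_lossMatrix.isHermitian

theorem lossMatrix_mulVec (V : S ⊕ L → ℝ) :
    N.lossMatrix *ᵥ V = Sum.elim (N.Yss *ᵥ src V + N.Ysl *ᵥ ld V)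
      (N.Yls *ᵥ src V + (N.Yll + N.YlMat) *ᵥ ld V) := by
  have hblocks : N.lossMatrix = Matrix.fromBlocks N.Yss N.Ysl N.Yls (N.Yll + N.YlMat) := by
    rw [lossMatrix, ← Matrix.fromBlocks_toBlocks N.Y, Matrix.fromBlocks_add]
    simp only [add_zero]
    rfl
  rw [hblocks, Matrix.fromBlocks_mulVec]
  rfl

theorem sum_lossMatrix_mulVec (V : S ⊕ L → ℝ) :
    ∑ k, (N.lossMatrix *ᵥ V) k = ∑ j, N.Yl j * ld V j := by
  simp only [lossMatrix_eq_Y_add_diagonal, Matrix.add_mulVec, Pi.add_apply,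
    Finset.sum_add_distrib, sum_Y_mulVec, zero_add]
  simp [Matrix.mulVec_diagonal, ld]

theorem dotProduct_mulVec_Y_add_diagonal_elim_one (x : S ⊕ L → ℝ) :
    x ⬝ᵥ (N.Y + Matrix.diagonal (Sum.elim 1 N.Yl)) *ᵥ x =
      x ⬝ᵥ N.lossMatrix *ᵥ x + ∑ i, src x i ^ 2 := by
  have hdiag : Matrix.diagonal (Sum.elim 1 N.Yl) =
      Matrix.diagonal (Sum.elim 0 N.Yl) + Matrix.diagonal (Sum.elim (1 : S → ℝ) 0) := by
    rw [Matrix.diagonal_add]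
    congr 1
    ext (i | j) <;> simp
  rw [hdiag, ← add_assoc, ← lossMatrix_eq_Y_add_diagonal, Matrix.add_mulVec, dotProduct_add]
  simp [dotProduct, Matrix.mulVec_diagonal, src, sq]

theorem eq_zero_of_dotProduct_lossMatrix_mulVec_eq_zero {x : S ⊕ L → ℝ}
    (hx : x ⬝ᵥ N.lossMatrix *ᵥ x = 0) (hsrc : src x = 0) : x = 0 := by
  by_contra hne
  have hpos := N.posDef_Y_add_diagonal_elim_one.dotProduct_mulVec_pos hne
  rw [star_trivial, dotProduct_mulVec_Y_add_diagonal_elim_one, hx, hsrc] at hpos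
  simp at hpos

theorem isBounded_setOf_dotProduct_lossMatrix_mulVec_le (a : ℝ) (b : S → ℝ) : Bornology.IsBounded
    {x : S ⊕ L → ℝ | x ⬝ᵥ N.lossMatrix *ᵥ x ≤ a ∧ ∀ i, |src x i| ≤ b i} := by
  refine (isBounded_setOf_dotProduct_mulVec_le N.posDef_Y_add_diagonal_elim_one
    (a + ∑ i, b i ^ 2)).subset fun x ⟨hx, hsrc⟩ ↦ ?_
  rw [mem_ofPred_eq, dotProduct_mulVec_Y_add_diagonal_elim_one]
  exact add_le_add hx
    (Finset.sum_le_sum fun i _ ↦ sq_le_sq.2 ((hsrc i).trans (le_abs_self _)))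

end Network

section Communication

variable {S L : Type*} [Fintype S] [DecidableEq S] (N : Microgrid S L)

theorem Lc_mulVec_eq_zero_iff {z : S → ℝ} : N.Lc *ᵥ z = 0 ↔ ∀ i k, z i = z k := by
  classical
  rw [Lc, SimpleGraph.lapMatrix_mulVec_eq_zero_iff_forall_reachable]
  exact forall₂_congr fun i k ↦ forall_prop_of_true (N.comm_connected.preconnected i k)

theorem posSemidef_Lc : N.Lc.PosSemidef := by
  classical
  exact SimpleGraph.posSemidef_lapMatrix ℝ N.comm

theorem sum_Lc_mulVec (z : S → ℝ) : ∑ i, (N.Lc *ᵥ z) i = 0 := by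
  classical
  exact sum_mulVec_eq_zero_of_isSymm (N.comm.isSymm_lapMatrix ℝ)
    (N.Lc_mulVec_eq_zero_iff.2 fun _ _ ↦ rfl) z

end Communication

section Leaf

variable {S L : Type*} [Fintype S] (N : Microgrid S L) {V W : S ⊕ L → ℝ}

theorem sum_inv_mul_C_pos {Vs : S → ℝ} (hVs : ∀ i, 0 < Vs i) : 0 < ∑ i, (Vs i)⁻¹ * N.C i := by
  have := N.comm_connected.nonempty
  exact Finset.sum_pos (fun i _ ↦ mul_pos (inv_pos.2 (hVs i)) (N.C_pos i)) Finset.univ_nonempty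

theorem mem_leaf_iff (hV : ∀ i, 0 < src V i) (hW : ∀ i, 0 < src W i) :
    V ∈ N.leaf W ↔ ∑ i, N.C i * Real.log (src V i) = ∑ i, N.C i * Real.log (src W i) := by
  have hprod {U : S ⊕ L → ℝ} (hU : ∀ i, 0 < src U i) :
      ∏ i, src U i ^ N.C i = Real.exp (∑ i, N.C i * Real.log (src U i)) := by
    simp only [Real.exp_sum, Real.rpow_def_of_pos (hU _), mul_comm]
  rw [leaf, mem_ofPred_eq, hprod hV, hprod hW, Real.exp_eq_exp]

theorem sum_C_mul_itakuraSaito (hV : ∀ i, 0 < src V i) (hW : ∀ i, 0 < src W i)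
    (hleaf : V ∈ N.leaf W) : ∑ i, N.C i * itakuraSaito (src V i) (src W i) =
      ∑ i, N.C i * (src V i / src W i - 1) := by
  have hlog := (N.mem_leaf_iff hV hW).1 hleaf
  rw [← sub_eq_zero, ← Finset.sum_sub_distrib, ← neg_eq_zero, ← Finset.sum_neg_distrib]
  rw [← sub_eq_zero, ← Finset.sum_sub_distrib] at hlog
  refine (Finset.sum_congr rfl fun i _ ↦ ?_).trans hlog
  rw [itakuraSaito, Real.log_div (hV i).ne' (hW i).ne']
  ring

theorem isClosed_leaf (V : S ⊕ L → ℝ) : IsClosed (N.leaf V) := by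
  refine isClosed_eq (continuous_finsetProd _ fun i _ ↦ ?_) continuous_const
  exact (continuous_apply (Sum.inl i)).rpow_const fun _ ↦ Or.inr (N.C_pos i).le

end Leaf

section Loads

variable {S L : Type*} [Fintype L] [DecidableEq L] [Nonempty L] (N : Microgrid S L)
  {V : S ⊕ L → ℝ}

theorem sum_loadCurrent_neg (hV : ∀ j, 0 < ld V j) : ∑ j, N.loadCurrent (ld V) j < 0 := by
  refine Finset.sum_neg (fun j _ ↦ ?_) Finset.univ_nonempty
  have hIl := N.Il_nonpos j
  have hYl := mul_nonneg (N.Yl_nonneg j) (hV j).le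
  simp only [loadCurrent, YlMat, Pi.sub_apply, Matrix.mulVec_diagonal]
  rcases N.load_nonzero j with h | h
  · linarith
  · linarith [mul_pos h (hV j)]

end Loads

section Equilibria

variable {S L : Type*} [Fintype S] [Fintype L] [DecidableEq S] [DecidableEq L]
  (N : Microgrid S L) {V W : S ⊕ L → ℝ} {p : ℝ}

theorem Ps_eq_mul_lossMatrix_mulVec (V : S ⊕ L → ℝ) (i : S) :
    N.Ps V i = src V i * (N.lossMatrix *ᵥ V) (Sum.inl i) := by
  rw [lossMatrix_mulVec, Sum.elim_inl, Ps]

theorem loadBalance_iff_mulVec_ld : N.LoadBalance V ↔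
    (N.Yll + N.YlMat) *ᵥ ld V = N.Il - N.Yls *ᵥ src V := by
  rw [LoadBalance, loadCurrent, Matrix.add_mulVec, sub_eq_iff_eq_add, eq_sub_iff_add_eq, eq_comm]
  exact Eq.congr (by abel) rfl

theorem loadBalance_iff_lossMatrix_mulVec :
    N.LoadBalance V ↔ ∀ j, (N.lossMatrix *ᵥ V) (Sum.inr j) = N.Il j := by
  rw [loadBalance_iff_mulVec_ld, lossMatrix_mulVec, eq_sub_iff_add_eq', funext_iff]
  rfl

theorem mulVec_loadVoltage (Vs : S → ℝ) :
    (N.Yll + N.YlMat) *ᵥ N.loadVoltage Vs = N.Il - N.Yls *ᵥ Vs := by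
  rw [loadVoltage, Matrix.mulVec_mulVec, Matrix.mul_nonsing_inv _
    ((Matrix.isUnit_iff_isUnit_det _).1 N.posDef_Yll_add_YlMat.isUnit), Matrix.one_mulVec]

theorem loadBalance_iff_ld_eq : N.LoadBalance V ↔ ld V = N.loadVoltage (src V) := by
  rw [loadBalance_iff_mulVec_ld, ← mulVec_loadVoltage]
  exact (Matrix.mulVec_injective_of_isUnit N.posDef_Yll_add_YlMat.isUnit).eq_iff

theorem sum_lossMatrix_mulVec_inl (hV : N.LoadBalance V) :
    ∑ i, (N.lossMatrix *ᵥ V) (Sum.inl i) = -∑ j, N.loadCurrent (ld V) j := by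
  have hsum := N.sum_lossMatrix_mulVec V
  simp only [Fintype.sum_sum_type, N.loadBalance_iff_lossMatrix_mulVec.1 hV] at hsum
  simp only [loadCurrent, YlMat, Pi.sub_apply, Matrix.mulVec_diagonal, Finset.sum_sub_distrib]
  linarith

theorem powerBalance_apply (hV : N.LoadBalance V) (i : S) :
    N.powerBalance (src V) i = N.Ps V i - N.C i * N.psStar (src V) := by
  simp only [powerBalance, Ps, N.loadBalance_iff_ld_eq.1 hV, loadVoltage, YredHat,
    Matrix.sub_mulVec, Matrix.mulVec_sub, Pi.add_apply, Pi.sub_apply, ← Matrix.mulVec_mulVec]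
  ring

theorem psStar_pos [Nonempty L] (hV : V ∈ N.equilibria) : 0 < N.psStar (src V) := by
  obtain ⟨hpos, -, hld⟩ := hV
  have hcur := N.sum_loadCurrent_neg (V := V) fun j ↦ hpos _
  rw [hld, loadCurrent] at hcur
  exact div_pos (neg_pos.2 hcur) (N.sum_inv_mul_C_pos fun i ↦ hpos _)

theorem loadBalance_of_mem_equilibria (hV : V ∈ N.equilibria) : N.LoadBalance V :=
  N.loadBalance_iff_ld_eq.2 hV.2.2

theorem Ps_eq_of_mem_equilibria (hV : V ∈ N.equilibria) (i : S) :
    N.Ps V i = N.C i * N.psStar (src V) := by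
  have hbal := congrFun hV.2.1 i
  rwa [N.powerBalance_apply (N.loadBalance_of_mem_equilibria hV), Pi.zero_apply, sub_eq_zero]
    at hbal

theorem Ps_pos_of_mem_equilibria [Nonempty L] (hV : V ∈ N.equilibria) (i : S) : 0 < N.Ps V i := by
  rw [N.Ps_eq_of_mem_equilibria hV]
  exact mul_pos (N.C_pos i) (N.psStar_pos hV)

theorem lossMatrix_mulVec_eq_div (hV : ∀ i, 0 < src V i) (hP : ∀ i, N.Ps V i = N.C i * p)
    (i : S) : (N.lossMatrix *ᵥ V) (Sum.inl i) = N.C i * p / src V i := by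
  rw [eq_div_iff (hV i).ne', ← hP, Ps_eq_mul_lossMatrix_mulVec, mul_comm]

theorem mem_equilibria_of_Ps_eq (hpos : V ∈ posOrthant S L) (hV : N.LoadBalance V)
    (hP : ∀ i, N.Ps V i = N.C i * p) : V ∈ N.equilibria := by
  have hld := N.loadBalance_iff_ld_eq.1 hV
  have hsrc : ∀ i, 0 < src V i := fun i ↦ hpos _
  have hp : N.psStar (src V) = p := by
    rw [psStar, ← hld, ← loadCurrent, ← N.sum_lossMatrix_mulVec_inl hV,
      div_eq_iff (N.sum_inv_mul_C_pos hsrc).ne', Finset.mul_sum]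
    refine Finset.sum_congr rfl fun i _ ↦ ?_
    rw [N.lossMatrix_mulVec_eq_div hsrc hP]
    ring
  refine ⟨hpos, funext fun i ↦ ?_, hld⟩
  rw [N.powerBalance_apply hV, hP, hp, sub_self, Pi.zero_apply]

theorem isEquilibrium_of_mem_equilibria (hV : V ∈ N.equilibria) : N.IsEquilibrium V := by
  refine ⟨hV.1, funext fun i ↦ ?_, N.loadBalance_of_mem_equilibria hV⟩
  have hker := N.Lc_mulVec_eq_zero_iff (z := fun k ↦ (N.C k)⁻¹ * N.Ps V k)
  rw [sourceRHS, hker.2 fun i k ↦ by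
    simp [N.Ps_eq_of_mem_equilibria hV, (N.C_pos _).ne']]
  simp

theorem eq_of_src_eq (hV : N.LoadBalance V) (hW : N.LoadBalance W) (h : src V = src W) :
    V = W := by
  have hld : ld V = ld W := by
    rw [N.loadBalance_iff_ld_eq.1 hV, N.loadBalance_iff_ld_eq.1 hW, h]
  ext (i | j)
  exacts [congrFun h i, congrFun hld j]

theorem dotProduct_lossMatrix_mulVec_sub_of_mem_leaf {q : ℝ} (hV : ∀ i, 0 < src V i)
    (hW : ∀ i, 0 < src W i) (hVbal : N.LoadBalance V) (hWbal : N.LoadBalance W)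
    (hPV : ∀ i, N.Ps V i = N.C i * p) (hPW : ∀ i, N.Ps W i = N.C i * q)
    (hleaf : V ∈ N.leaf W) :
    (V - W) ⬝ᵥ N.lossMatrix *ᵥ (V - W) + q * ∑ i, N.C i * itakuraSaito (src V i) (src W i) +
      p * ∑ i, N.C i * itakuraSaito (src W i) (src V i) = 0 := by
  have hleaf' : W ∈ N.leaf V := hleaf.symm
  rw [N.sum_C_mul_itakuraSaito hV hW hleaf, N.sum_C_mul_itakuraSaito hW hV hleaf']
  simp only [dotProduct, Fintype.sum_sum_type, Matrix.mulVec_sub, Pi.sub_apply,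
    N.loadBalance_iff_lossMatrix_mulVec.1 hVbal, N.loadBalance_iff_lossMatrix_mulVec.1 hWbal,
    N.lossMatrix_mulVec_eq_div hV hPV, N.lossMatrix_mulVec_eq_div hW hPW, sub_self, mul_zero,
    Finset.sum_const_zero, add_zero, Finset.mul_sum, ← Finset.sum_add_distrib]
  refine Finset.sum_eq_zero fun i _ ↦ ?_
  have hVi := (hV i).ne'
  have hWi := (hW i).ne'
  change (src V i - src W i) * _ + _ + _ = 0
  field_simp
  ring

theorem eq_of_mem_equilibria_of_mem_leaf [Nonempty L] (hV : V ∈ N.equilibria)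
    (hW : W ∈ N.equilibria) (hleaf : V ∈ N.leaf W) : V = W := by
  have hVs : ∀ i, 0 < src V i := fun i ↦ hV.1 _
  have hWs : ∀ i, 0 < src W i := fun i ↦ hW.1 _
  have hVbal := N.loadBalance_of_mem_equilibria hV
  have hWbal := N.loadBalance_of_mem_equilibria hW
  have hterm (i : S) : 0 ≤ N.C i * itakuraSaito (src V i) (src W i) :=
    mul_nonneg (N.C_pos i).le (itakuraSaito_nonneg (hVs i) (hWs i))
  have hzero : ∑ i, N.C i * itakuraSaito (src V i) (src W i) = 0 := by
    have hsum := N.dotProduct_lossMatrix_mulVec_sub_of_mem_leaf hVs hWs hVbal hWbal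
      (N.Ps_eq_of_mem_equilibria hV) (N.Ps_eq_of_mem_equilibria hW) hleaf
    have hloss := N.posSemidef_lossMatrix.dotProduct_mulVec_nonneg (V - W)
    have hWV := mul_nonneg (N.psStar_pos hV).le (Finset.sum_nonneg fun i (_ : i ∈ Finset.univ) ↦
      mul_nonneg (N.C_pos i).le (itakuraSaito_nonneg (hWs i) (hVs i)))
    rw [star_trivial] at hloss
    exact le_antisymm (nonpos_of_mul_nonpos_right (by linarith) (N.psStar_pos hW))
      (Finset.sum_nonneg fun i _ ↦ hterm i)
  rw [Finset.sum_eq_zero_iff_of_nonneg fun i _ ↦ hterm i] at hzero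
  refine N.eq_of_src_eq hVbal hWbal (funext fun i ↦ ?_)
  exact (itakuraSaito_eq_zero_iff (hVs i) (hWs i)).1
    ((mul_eq_zero.1 (hzero i (Finset.mem_univ i))).resolve_left (N.C_pos i).ne')

end Equilibria

section Energy

variable {S L : Type*} [Fintype S] [Fintype L] [DecidableEq S] [DecidableEq L]
  (N : Microgrid S L) {A V : S ⊕ L → ℝ} {c : ℝ}

theorem hasFDerivAt_energy (A : S ⊕ L → ℝ) (hV : ∀ i, src V i ≠ 0) :
    HasFDerivAt (N.energy A)
      (∑ k, (N.lossMatrix *ᵥ V) k • ContinuousLinearMap.proj (R := ℝ) (φ := fun _ : S ⊕ L ↦ ℝ) k -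
        ∑ i, (N.Ps A i / src V i) •
          ContinuousLinearMap.proj (R := ℝ) (φ := fun _ : S ⊕ L ↦ ℝ) (Sum.inl i)) V := by
  refine (hasFDerivAt_half_dotProduct_mulVec N.isSymm_lossMatrix V).sub
    (HasFDerivAt.fun_sum fun i _ ↦ ?_)
  simpa only [smul_smul, div_eq_mul_inv] using!
    ((hasFDerivAt_apply (Sum.inl i) V).log (hV i)).const_mul (N.Ps A i)

theorem fderiv_energy_self_apply (hA : ∀ i, src A i ≠ 0) (h : S ⊕ L → ℝ) :
    fderiv ℝ (N.energy A) A h = ∑ j, (N.lossMatrix *ᵥ A) (Sum.inr j) * ld h j := by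
  rw [(N.hasFDerivAt_energy A hA).fderiv]
  simp [Ps_eq_mul_lossMatrix_mulVec, hA, ld]

theorem differentiableAt_bregman (A : S ⊕ L → ℝ) (hV : ∀ i, src V i ≠ 0) :
    DifferentiableAt ℝ (N.bregman A) V := by
  have := (N.hasFDerivAt_energy A hV).differentiableAt
  unfold bregman
  fun_prop

theorem fderiv_bregman_apply (hA : ∀ i, src A i ≠ 0) (hV : ∀ i, src V i ≠ 0)
    (hAbal : N.LoadBalance A) (hVbal : N.LoadBalance V) (h : S ⊕ L → ℝ) :
    fderiv ℝ (N.bregman A) V h = ∑ i, (N.Ps V i - N.Ps A i) * (src h i / src V i) := by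
  have hshift : HasFDerivAt (fun W ↦ fderiv ℝ (N.energy A) A (W - A))
      (fderiv ℝ (N.energy A) A) V :=
    (fderiv ℝ (N.energy A) A).hasFDerivAt.comp V ((hasFDerivAt_id V).sub_const A)
  have hfderiv : fderiv ℝ (N.bregman A) V = _ :=
    (((N.hasFDerivAt_energy A hV).sub_const (N.energy A A)).sub hshift).fderiv
  have hterm (i : S) : (N.Ps V i - N.Ps A i) * (src h i / src V i) =
      (N.lossMatrix *ᵥ V) (Sum.inl i) * src h i - N.Ps A i / src V i * src h i := by
    rw [Ps_eq_mul_lossMatrix_mulVec N V]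
    field_simp [hV i]
  rw [hfderiv, sub_apply, N.fderiv_energy_self_apply hA]
  simp only [hterm, Finset.sum_sub_distrib]
  simp only [Fintype.sum_sum_type, N.loadBalance_iff_lossMatrix_mulVec.1 hAbal,
    N.loadBalance_iff_lossMatrix_mulVec.1 hVbal, src, ld, sub_apply, add_apply, sum_apply,
    smul_apply, ContinuousLinearMap.proj_apply, smul_eq_mul]
  ring

theorem bregman_eq (hA : ∀ i, 0 < src A i) (hV : ∀ i, 0 < src V i) :
    N.bregman A V = 1 / 2 * ((V - A) ⬝ᵥ N.lossMatrix *ᵥ (V - A)) +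
      ∑ i, N.Ps A i * itakuraSaito (src V i) (src A i) := by
  have hdiv : ∑ i, N.Ps A i * itakuraSaito (src V i) (src A i) =
      ∑ i, (N.lossMatrix *ᵥ A) (Sum.inl i) * (src V i - src A i) -
        (∑ i, N.Ps A i * Real.log (src V i) - ∑ i, N.Ps A i * Real.log (src A i)) := by
    simp only [← Finset.sum_sub_distrib]
    refine Finset.sum_congr rfl fun i _ ↦ ?_
    rw [itakuraSaito, Real.log_div (hV i).ne' (hA i).ne', Ps_eq_mul_lossMatrix_mulVec]
    field_simp [(hA i).ne']
    ring
  have hcomm := dotProduct_mulVec_comm_of_isSymm N.isSymm_lossMatrix A V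
  have hlin : (V - A) ⬝ᵥ N.lossMatrix *ᵥ A =
      ∑ i, (N.lossMatrix *ᵥ A) (Sum.inl i) * (src V i - src A i) +
        ∑ j, (N.lossMatrix *ᵥ A) (Sum.inr j) * ld (V - A) j := by
    simp only [dotProduct, Fintype.sum_sum_type, mul_comm, Pi.sub_apply, src, ld]
  rw [bregman, N.fderiv_energy_self_apply fun i ↦ (hA i).ne', hdiv, energy, energy, losses, losses,
    ← lossMatrix]
  simp only [Matrix.mulVec_sub, dotProduct_sub, sub_dotProduct] at hlin ⊢
  linarith

theorem sublevel_mem_nhds (hA : ∀ i, 0 < src A i) (hc : 0 < c) : N.sublevel A c ∈ 𝓝 A := by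
  have hcont : ContinuousAt (N.bregman A) A :=
    (N.differentiableAt_bregman A fun i ↦ (hA i).ne').continuousAt
  have hsrc (i : S) : ∀ᶠ V in 𝓝 A, 0 < src V i :=
    (continuous_apply (Sum.inl i)).continuousAt.eventually_const_lt (hA i)
  filter_upwards [eventually_all.2 hsrc, hcont.eventually_le_const (u := c) (by simpa [bregman])]
    with V hV hVc using ⟨hV, hVc⟩

variable (hA : ∀ i, 0 < src A i) (hP : ∀ i, 0 < N.Ps A i)
include hA hP

theorem Ps_mul_itakuraSaito_nonneg (hV : ∀ i, 0 < src V i) (i : S) :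
    0 ≤ N.Ps A i * itakuraSaito (src V i) (src A i) :=
  mul_nonneg (hP i).le (itakuraSaito_nonneg (hV i) (hA i))

theorem dotProduct_lossMatrix_mulVec_sub_le_of_mem_sublevel (hV : V ∈ N.sublevel A c) :
    (V - A) ⬝ᵥ N.lossMatrix *ᵥ (V - A) ≤ 2 * c := by
  have hsum := Finset.sum_nonneg fun i (_ : i ∈ Finset.univ) ↦
    N.Ps_mul_itakuraSaito_nonneg hA hP hV.1 i
  linarith [N.bregman_eq hA hV.1, hV.2]

theorem itakuraSaito_le_of_mem_sublevel (hV : V ∈ N.sublevel A c) (i : S) :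
    itakuraSaito (src V i) (src A i) ≤ c / N.Ps A i := by
  have hterm := Finset.single_le_sum
    (fun k _ ↦ N.Ps_mul_itakuraSaito_nonneg hA hP hV.1 k) (Finset.mem_univ i)
  have hloss := N.posSemidef_lossMatrix.dotProduct_mulVec_nonneg (V - A)
  rw [star_trivial] at hloss
  rw [le_div_iff₀' (hP i)]
  linarith [N.bregman_eq hA hV.1, hV.2]

theorem src_mem_Icc_of_mem_sublevel (hV : V ∈ N.sublevel A c) (i : S) :
    src V i ∈ Icc (src A i * Real.exp (-(c / N.Ps A i + 1)))
      (src A i * Real.exp (c / N.Ps A i + 1)) :=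
  mem_Icc_of_itakuraSaito_le (hV.1 i) (hA i) (N.itakuraSaito_le_of_mem_sublevel hA hP hV i)

theorem sublevel_zero : N.sublevel A 0 = {A} := by
  refine Subset.antisymm (fun V hV ↦ ?_) (singleton_subset_iff.2 ⟨hA, by simp [bregman]⟩)
  have hsrc : src V = src A := funext fun i ↦ by
    refine (itakuraSaito_eq_zero_iff (hV.1 i) (hA i)).1 (le_antisymm ?_
      (itakuraSaito_nonneg (hV.1 i) (hA i)))
    simpa using N.itakuraSaito_le_of_mem_sublevel hA hP hV i
  have hloss : (V - A) ⬝ᵥ N.lossMatrix *ᵥ (V - A) = 0 :=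
    le_antisymm (by simpa using N.dotProduct_lossMatrix_mulVec_sub_le_of_mem_sublevel hA hP hV)
      (by simpa using N.posSemidef_lossMatrix.dotProduct_mulVec_nonneg (V - A))
  exact sub_eq_zero.1 (N.eq_zero_of_dotProduct_lossMatrix_mulVec_eq_zero hloss
    (funext fun i ↦ sub_eq_zero.2 (congrFun hsrc i)))

theorem isBounded_sublevel (c : ℝ) : Bornology.IsBounded (N.sublevel A c) := by
  have hbounded := N.isBounded_setOf_dotProduct_lossMatrix_mulVec_le (2 * c)
    fun i ↦ src A i * Real.exp (c / N.Ps A i + 1) + src A i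
  refine ((IsometryEquiv.subRight A).isometry.antilipschitz.isBounded_preimage hbounded).subset
    fun V hV ↦ ⟨N.dotProduct_lossMatrix_mulVec_sub_le_of_mem_sublevel hA hP hV, fun i ↦ ?_⟩
  have hle := (N.src_mem_Icc_of_mem_sublevel hA hP hV i).2
  refine (abs_sub (src V i) (src A i)).trans ?_
  rw [abs_of_pos (hV.1 i), abs_of_pos (hA i)]
  gcongr

theorem isClosed_sublevel (c : ℝ) : IsClosed (N.sublevel A c) := by
  let s : Set (S ⊕ L → ℝ) := ⋂ i, {V | src A i * Real.exp (-(c / N.Ps A i + 1)) ≤ src V i}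
  have hs : IsClosed s :=
    isClosed_iInter fun i ↦ isClosed_le continuous_const (continuous_apply (Sum.inl i))
  have hpos {V} (hV : V ∈ s) (i : S) : 0 < src V i :=
    (mul_pos (hA i) (Real.exp_pos _)).trans_le (mem_iInter.1 hV i)
  have heq : N.sublevel A c = s ∩ N.bregman A ⁻¹' Iic c := by
    ext V
    exact ⟨fun hV ↦ ⟨mem_iInter.2 fun i ↦ (N.src_mem_Icc_of_mem_sublevel hA hP hV i).1, hV.2⟩,
      fun hV ↦ ⟨hpos hV.1, hV.2⟩⟩
  rw [heq]
  refine ContinuousOn.preimage_isClosed_of_isClosed (fun V hV ↦ ?_) hs isClosed_Iic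
  exact (N.differentiableAt_bregman A fun i ↦
    (hpos hV i).ne').continuousAt.continuousWithinAt

theorem isCompact_sublevel (c : ℝ) : IsCompact (N.sublevel A c) :=
  Metric.isCompact_of_isClosed_isBounded (N.isClosed_sublevel hA hP c)
    (N.isBounded_sublevel hA hP c)

theorem sublevel_subset_of_mem_nhds {U : Set (S ⊕ L → ℝ)} (hU : U ∈ 𝓝 A) :
    ∃ c > 0, N.sublevel A c ⊆ U := by
  have hmono {a b : ℝ} (hab : a ≤ b) : N.sublevel A a ⊆ N.sublevel A b :=
    fun V hV ↦ ⟨hV.1, hV.2.trans hab⟩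
  have hdirected : Directed (· ⊇ ·) fun c : Ioi (0 : ℝ) ↦ N.sublevel A c :=
    directed_of_isDirected_ge fun _ _ hab ↦ hmono hab
  have hinter : ⋂ c : Ioi (0 : ℝ), N.sublevel A c ⊆ {A} := by
    intro V hV
    rw [← N.sublevel_zero hA hP]
    simp only [mem_iInter] at hV
    exact ⟨(hV ⟨1, mem_Ioi.2 one_pos⟩).1, le_of_forall_pos_le_add fun ε hε ↦ by
      simpa using (hV ⟨ε, hε⟩).2⟩
  obtain ⟨c, hc⟩ := exists_subset_nhds_of_isCompact hdirected
    (fun c ↦ N.isCompact_sublevel hA hP c) (U := U) fun V hV ↦ by rwa [hinter hV]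
  exact ⟨c, c.2, hc⟩

end Energy

section SourceCoordinates

variable {S L : Type*} [Fintype S] [Fintype L] [DecidableEq S] [DecidableEq L]
  (N : Microgrid S L) {V W : S ⊕ L → ℝ}

/-- The load-balanced state with source voltages `x`: the load equation is solved for `V_l`. -/
def balanced (x : S → ℝ) : S ⊕ L → ℝ := Sum.elim x (N.loadVoltage x)

/-- The load-balanced state whose source voltages have logarithms `u`. -/
def ofLog (u : S → ℝ) : S ⊕ L → ℝ := N.balanced fun i ↦ Real.exp (u i)

/-- The power injections `C_s⁻¹ P_s` relative to the controller weights; the controllers drive them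
to consensus. -/
def normalizedPs (V : S ⊕ L → ℝ) : S → ℝ := fun i ↦ (N.C i)⁻¹ * N.Ps V i

/-- The logarithmic derivatives `-C_s⁻¹ L_c C_s⁻¹ P_s` of the source voltages along solutions of the
closed-loop system. -/
def growthRate (V : S ⊕ L → ℝ) : S → ℝ := fun i ↦ -((N.C i)⁻¹ * (N.Lc *ᵥ N.normalizedPs V) i)

theorem src_ofLog_pos (u : S → ℝ) (i : S) : 0 < src (N.ofLog u) i := Real.exp_pos _

theorem loadBalance_balanced (x : S → ℝ) : N.LoadBalance (N.balanced x) :=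
  N.loadBalance_iff_ld_eq.2 rfl

theorem balanced_src (hV : N.LoadBalance V) : N.balanced (src V) = V := by
  rw [balanced, ← N.loadBalance_iff_ld_eq.1 hV]
  exact Sum.elim_comp_inl_inr V

theorem ofLog_log_src (hs : ∀ i, 0 < src V i) (hV : N.LoadBalance V) :
    N.ofLog (fun i ↦ Real.log (src V i)) = V := by
  simp only [ofLog, Real.exp_log (hs _)]
  exact N.balanced_src hV

theorem C_mul_growthRate (V : S ⊕ L → ℝ) (i : S) :
    N.C i * N.growthRate V i = -(N.Lc *ᵥ N.normalizedPs V) i := by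
  rw [growthRate, mul_neg, mul_inv_cancel_left₀ (N.C_pos i).ne']

theorem sourceRHS_eq (V : S ⊕ L → ℝ) (i : S) :
    N.sourceRHS V i = N.C i * (src V i * N.growthRate V i) := by
  rw [mul_left_comm, C_mul_growthRate, mul_neg]
  rfl

theorem sum_C_mul_growthRate (V : S ⊕ L → ℝ) : ∑ i, N.C i * N.growthRate V i = 0 := by
  simp only [C_mul_growthRate, Finset.sum_neg_distrib, sum_Lc_mulVec, neg_zero]

theorem sum_Ps_sub_mul_growthRate (hW : W ∈ N.equilibria) (V : S ⊕ L → ℝ) :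
    ∑ i, (N.Ps V i - N.Ps W i) * N.growthRate V i =
      -(N.normalizedPs V ⬝ᵥ N.Lc *ᵥ N.normalizedPs V) := by
  have hterm (i : S) : (N.Ps V i - N.Ps W i) * N.growthRate V i =
      -(N.normalizedPs V i * (N.Lc *ᵥ N.normalizedPs V) i) -
        N.psStar (src W) * (N.C i * N.growthRate V i) := by
    rw [N.Ps_eq_of_mem_equilibria hW, sub_mul, mul_assoc, mul_left_comm (N.C i), growthRate,
      normalizedPs]
    ring
  simp only [hterm, Finset.sum_sub_distrib, ← Finset.mul_sum, sum_C_mul_growthRate, mul_zero,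
    sub_zero, Finset.sum_neg_distrib, dotProduct]

theorem mem_equilibria_of_dotProduct_Lc_mulVec_eq_zero (hpos : V ∈ posOrthant S L)
    (hV : N.LoadBalance V) (hz : N.normalizedPs V ⬝ᵥ N.Lc *ᵥ N.normalizedPs V = 0) :
    V ∈ N.equilibria := by
  obtain ⟨i₀⟩ := N.comm_connected.nonempty
  have hker : N.Lc *ᵥ N.normalizedPs V = 0 :=
    (N.posSemidef_Lc.dotProduct_mulVec_zero_iff _).1 (by rwa [star_trivial])
  refine N.mem_equilibria_of_Ps_eq hpos hV (p := N.normalizedPs V i₀) fun i ↦ ?_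
  rw [← N.Lc_mulVec_eq_zero_iff.1 hker i i₀, normalizedPs, mul_inv_cancel_left₀ (N.C_pos i).ne']

theorem contDiff_balanced : ContDiff ℝ 1 N.balanced := by
  refine contDiff_pi.2 (Sum.rec (fun i ↦ contDiff_apply ℝ ℝ i) fun j ↦ ?_)
  simp only [balanced, Sum.elim_inr, loadVoltage, Matrix.mulVec, dotProduct, Pi.sub_apply]
  fun_prop

theorem contDiff_ofLog : ContDiff ℝ 1 N.ofLog :=
  N.contDiff_balanced.comp (contDiff_pi.2 fun i ↦ (contDiff_apply ℝ ℝ i).exp)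

theorem contDiff_normalizedPs : ContDiff ℝ 1 N.normalizedPs := by
  unfold normalizedPs Ps src ld Matrix.mulVec dotProduct
  simp only [Pi.add_apply]
  fun_prop

theorem contDiff_growthRate : ContDiff ℝ 1 N.growthRate := by
  have := N.contDiff_normalizedPs
  unfold growthRate Matrix.mulVec dotProduct
  fun_prop

end SourceCoordinates

section Dynamics

variable {S L : Type*} [Fintype S] [Fintype L] [DecidableEq S] [DecidableEq L]
  (N : Microgrid S L)

/-- The closed-loop vector field in terms of the source voltages. -/
def sourceField (x : S → ℝ) : S → ℝ := x * N.growthRate (N.balanced x)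

/-- The closed-loop vector field in terms of the logarithms of the source voltages. -/
def logField (u : S → ℝ) : S → ℝ := N.growthRate (N.ofLog u)

theorem contDiff_sourceField : ContDiff ℝ 1 N.sourceField :=
  contDiff_id.mul (N.contDiff_growthRate.comp N.contDiff_balanced)

theorem contDiff_logField : ContDiff ℝ 1 N.logField :=
  N.contDiff_growthRate.comp N.contDiff_ofLog

variable {N} {J J' : Set ℝ} {T : ℝ} {V W : ℝ → S ⊕ L → ℝ} {u : ℝ → S → ℝ}

theorem IsSolution.mono (hV : N.IsSolution J V) (hJ : J' ⊆ J) : N.IsSolution J' V :=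
  ⟨fun t ht i ↦ (hV.source t (hJ ht) i).mono hJ, fun t ht ↦ hV.load t (hJ ht)⟩

theorem IsSolution.isIntegralCurveOn_src (hV : N.IsSolution J V) :
    IsIntegralCurveOn (fun t ↦ src (V t)) (fun _ ↦ N.sourceField) J := by
  refine fun t ht ↦ hasDerivWithinAt_pi.2 fun i ↦ ?_
  have hC := (N.C_pos i).ne'
  simpa only [sourceRHS_eq, inv_mul_cancel_left₀ hC, sourceField, Pi.mul_apply,
    N.balanced_src (hV.load t ht)] using (hV.source t ht i).const_mul (N.C i)⁻¹

theorem IsSolution.eqOn_Ico (hV : N.IsSolution (Ico 0 T) V) (hW : N.IsSolution (Ico 0 T) W)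
    (h0 : V 0 = W 0) : EqOn V W (Ico 0 T) := by
  intro t ht
  have hsrc := eqOn_Ico_of_isIntegralCurveOn N.contDiff_sourceField.locallyLipschitz
    hV.isIntegralCurveOn_src hW.isIntegralCurveOn_src (congrArg src h0) ht
  rw [← N.balanced_src (hV.load t ht), ← N.balanced_src (hW.load t ht)]
  exact congrArg N.balanced hsrc

theorem isSolution_ofLog (hu : IsIntegralCurveOn u (fun _ ↦ N.logField) J) :
    N.IsSolution J fun t ↦ N.ofLog (u t) := by
  refine ⟨fun t ht i ↦ ?_, fun t _ ↦ N.loadBalance_balanced _⟩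
  rw [sourceRHS_eq]
  exact (hasDerivWithinAt_pi.1 (hu t ht) i).exp.const_mul (N.C i)

theorem ofLog_mem_leaf (hu : IsIntegralCurveOn u (fun _ ↦ N.logField) (Ici 0)) {t : ℝ}
    (ht : 0 ≤ t) : N.ofLog (u t) ∈ N.leaf (N.ofLog (u 0)) := by
  have hderiv (s : ℝ) (hs : 0 ≤ s) :
      HasDerivWithinAt (fun τ ↦ ∑ i, N.C i * u τ i) 0 (Ici 0) s := by
    simpa only [logField, sum_C_mul_growthRate] using HasDerivWithinAt.fun_sum
      fun i (_ : i ∈ Finset.univ) ↦ (hasDerivWithinAt_pi.1 (hu s hs) i).const_mul (N.C i)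
  have hconst := constant_of_has_deriv_right_zero
    (fun s hs ↦ (hderiv s hs.1).continuousWithinAt.mono Icc_subset_Ici_self)
    (fun s hs ↦ (hderiv s hs.1).mono (Ici_subset_Ici.2 hs.1)) t (right_mem_Icc.2 ht)
  rw [N.mem_leaf_iff (N.src_ofLog_pos _) (N.src_ofLog_pos _)]
  simpa only [ofLog, balanced, src, Sum.elim_inl, Real.log_exp] using hconst

end Dynamics

section Lyapunov

variable {S L : Type*} [Fintype S] [Fintype L] [DecidableEq S] [DecidableEq L]
  (N : Microgrid S L) {A : S ⊕ L → ℝ}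

theorem differentiable_bregman_ofLog (A : S ⊕ L → ℝ) :
    Differentiable ℝ fun u ↦ N.bregman A (N.ofLog u) := fun u ↦
  (N.differentiableAt_bregman A fun i ↦ (N.src_ofLog_pos u i).ne').comp u
    (N.contDiff_ofLog.differentiable one_ne_zero u)

theorem fderiv_bregman_ofLog_apply (hA : ∀ i, src A i ≠ 0) (hAbal : N.LoadBalance A)
    (u v : S → ℝ) : fderiv ℝ (fun u ↦ N.bregman A (N.ofLog u)) u v =
      ∑ i, (N.Ps (N.ofLog u) i - N.Ps A i) * v i := by
  have hpos (i : S) : src (N.ofLog u) i ≠ 0 := (N.src_ofLog_pos u i).ne'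
  have hofLog := N.contDiff_ofLog.differentiable one_ne_zero u
  have hsrc (i : S) : src (fderiv ℝ N.ofLog u v) i = src (N.ofLog u) i * v i :=
    congrArg (· v) ((hasFDerivAt_pi'.1 hofLog.hasFDerivAt (Sum.inl i)).unique
      (hasFDerivAt_apply i u).exp)
  rw [fderiv_fun_comp u (N.differentiableAt_bregman A hpos) hofLog, ContinuousLinearMap.comp_apply,
    N.fderiv_bregman_apply hA hpos hAbal (N.loadBalance_balanced _)]
  simp only [hsrc, mul_div_cancel_left₀ _ (hpos _)]

theorem fderiv_bregman_ofLog_logField (hA : A ∈ N.equilibria) (u : S → ℝ) :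
    fderiv ℝ (fun u ↦ N.bregman A (N.ofLog u)) u (N.logField u) =
      -(N.normalizedPs (N.ofLog u) ⬝ᵥ N.Lc *ᵥ N.normalizedPs (N.ofLog u)) := by
  rw [N.fderiv_bregman_ofLog_apply (fun i ↦ (hA.1 _).ne') (N.loadBalance_of_mem_equilibria hA)]
  exact N.sum_Ps_sub_mul_growthRate hA _

theorem fderiv_bregman_ofLog_logField_nonpos (hA : A ∈ N.equilibria) (u : S → ℝ) :
    fderiv ℝ (fun u ↦ N.bregman A (N.ofLog u)) u (N.logField u) ≤ 0 := by
  rw [N.fderiv_bregman_ofLog_logField hA, neg_nonpos, ← star_trivial (N.normalizedPs _)]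
  exact N.posSemidef_Lc.dotProduct_mulVec_nonneg _

theorem continuous_fderiv_bregman_ofLog_logField (hA : A ∈ N.equilibria) :
    Continuous fun u ↦ fderiv ℝ (fun u ↦ N.bregman A (N.ofLog u)) u (N.logField u) := by
  have hz := N.contDiff_normalizedPs.continuous.comp N.contDiff_ofLog.continuous
  simp only [N.fderiv_bregman_ofLog_logField hA]
  exact (hz.dotProduct (continuous_const.matrix_mulVec hz)).neg

theorem isCompact_setOf_bregman_ofLog_le (hA : ∀ i, 0 < src A i) (hP : ∀ i, 0 < N.Ps A i) (c : ℝ) :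
    IsCompact {u | N.bregman A (N.ofLog u) ≤ c} := by
  have hclosed : IsClosed {u | N.bregman A (N.ofLog u) ≤ c} :=
    isClosed_le (N.differentiable_bregman_ofLog A).continuous continuous_const
  have hIcc : IsCompact (univ.pi fun i : S ↦ Icc
      (Real.log (src A i * Real.exp (-(c / N.Ps A i + 1))))
      (Real.log (src A i * Real.exp (c / N.Ps A i + 1)))) :=
    isCompact_univ_pi fun _ ↦ isCompact_Icc
  refine hIcc.of_isClosed_subset hclosed fun u hu i _ ↦ ?_
  obtain ⟨hlower, hupper⟩ := N.src_mem_Icc_of_mem_sublevel hA hP ⟨N.src_ofLog_pos u, hu⟩ i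
  exact ⟨(Real.log_le_iff_le_exp (mul_pos (hA i) (Real.exp_pos _))).2 hlower,
    (Real.le_log_iff_exp_le (mul_pos (hA i) (Real.exp_pos _))).2 hupper⟩

end Lyapunov

section Convergence

variable {S L : Type*} [Fintype S] [Fintype L] [DecidableEq S] [DecidableEq L] {N : Microgrid S L}
  {A V : S ⊕ L → ℝ} {W : ℝ → S ⊕ L → ℝ} {u : ℝ → S → ℝ} {c T : ℝ}

theorem ofLog_mem_sublevel_of_le (hA : A ∈ N.equilibria)
    (hu : IsIntegralCurveOn u (fun _ ↦ N.logField) (Ici 0)) {s t : ℝ} (hs : 0 ≤ s) (hst : s ≤ t)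
    (hmem : N.ofLog (u s) ∈ N.sublevel A c) : N.ofLog (u t) ∈ N.sublevel A c :=
  ⟨N.src_ofLog_pos _, (antitoneOn_comp_of_isIntegralCurveOn (convex_Ici 0)
    (N.differentiable_bregman_ofLog A) (N.fderiv_bregman_ofLog_logField_nonpos hA) hu hs
    (hs.trans hst) hst).trans hmem.2⟩

theorem IsSolution.eqOn_ofLog (hW : N.IsSolution (Ico 0 T) W)
    (hu : IsIntegralCurveOn u (fun _ ↦ N.logField) (Ici 0)) (h0 : W 0 = N.ofLog (u 0)) :
    EqOn W (fun t ↦ N.ofLog (u t)) (Ico 0 T) :=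
  hW.eqOn_Ico ((isSolution_ofLog hu).mono Ico_subset_Ici_self) h0

theorem posOrthant_mem_nhds {ι κ : Type*} [Finite ι] [Finite κ] {V : ι ⊕ κ → ℝ}
    (hV : V ∈ posOrthant ι κ) : posOrthant ι κ ∈ 𝓝 V :=
  eventually_all.2 fun k ↦ (continuous_apply k).continuousAt.eventually_const_lt (hV k)

variable [Nonempty L]

theorem exists_isIntegralCurveOn_logField (hA : A ∈ N.equilibria) (hV : V ∈ N.sublevel A c)
    (hbal : N.LoadBalance V) :
    ∃ u, N.ofLog (u 0) = V ∧ IsIntegralCurveOn u (fun _ ↦ N.logField) (Ici 0) := by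
  obtain ⟨u, hu0, hu⟩ := exists_isIntegralCurveOn_Ici_of_isCompact_sublevel N.contDiff_logField
    (N.differentiable_bregman_ofLog A) (N.fderiv_bregman_ofLog_logField_nonpos hA)
    (N.isCompact_setOf_bregman_ofLog_le (fun _ ↦ hA.1 _) (N.Ps_pos_of_mem_equilibria hA) _)
  exact ⟨u, by rw [hu0, N.ofLog_log_src hV.1 hbal], hu⟩

theorem exists_mapClusterPt_ofLog (hA : A ∈ N.equilibria) (hc : N.sublevel A c ⊆ posOrthant S L)
    (hu : IsIntegralCurveOn u (fun _ ↦ N.logField) (Ici 0))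
    (h0 : N.ofLog (u 0) ∈ N.sublevel A c) :
    ∃ Ve ∈ N.equilibria ∩ N.sublevel A c, MapClusterPt Ve atTop fun t ↦ N.ofLog (u t) := by
  obtain ⟨x, hx, hx0, hcluster⟩ := exists_mapClusterPt_fderiv_apply_eq_zero
    (N.differentiable_bregman_ofLog A) (N.continuous_fderiv_bregman_ofLog_logField hA) hu
    (N.isCompact_setOf_bregman_ofLog_le (fun _ ↦ hA.1 _) (N.Ps_pos_of_mem_equilibria hA) c)
    fun t ht ↦ (ofLog_mem_sublevel_of_le hA hu le_rfl ht h0).2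
  rw [N.fderiv_bregman_ofLog_logField hA, neg_eq_zero] at hx0
  have hsub : N.ofLog x ∈ N.sublevel A c := ⟨N.src_ofLog_pos x, hx⟩
  exact ⟨N.ofLog x, ⟨N.mem_equilibria_of_dotProduct_Lc_mulVec_eq_zero (hc hsub)
    (N.loadBalance_balanced _) hx0, hsub⟩,
    hcluster.continuousAt_comp N.contDiff_ofLog.continuous.continuousAt⟩

-- LaSalle only gives a limit point; the Bregman function centred at that point forces convergence.
theorem exists_tendsto_ofLog (hA : A ∈ N.equilibria) (hc : N.sublevel A c ⊆ posOrthant S L)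
    (hu : IsIntegralCurveOn u (fun _ ↦ N.logField) (Ici 0))
    (h0 : N.ofLog (u 0) ∈ N.sublevel A c) :
    ∃ Ve ∈ N.equilibria ∩ N.sublevel A c, Ve ∈ N.leaf (N.ofLog (u 0)) ∧
      Tendsto (fun t ↦ N.ofLog (u t)) atTop (𝓝 Ve) := by
  obtain ⟨Ve, hVe, hcluster⟩ := exists_mapClusterPt_ofLog hA hc hu h0
  have hlim : Tendsto (fun t ↦ N.ofLog (u t)) atTop (𝓝 Ve) := by
    refine tendsto_of_mapClusterPt_of_stable hcluster fun U hU ↦ ?_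
    obtain ⟨d, hd, hsub⟩ := N.sublevel_subset_of_mem_nhds (fun _ ↦ hVe.1.1 _)
      (N.Ps_pos_of_mem_equilibria hVe.1) hU
    refine ⟨N.sublevel Ve d, N.sublevel_mem_nhds (fun _ ↦ hVe.1.1 _) hd, ?_⟩
    filter_upwards [eventually_ge_atTop 0] with s hs hmem t ht
    exact hsub (ofLog_mem_sublevel_of_le hVe.1 hu hs ht hmem)
  exact ⟨Ve, hVe, (N.isClosed_leaf _).mem_of_tendsto hlim
    ((eventually_ge_atTop 0).mono fun t ht ↦ ofLog_mem_leaf hu ht), hlim⟩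

theorem lyapunovStable_of_mem_equilibria (hA : A ∈ N.equilibria) : N.LyapunovStable A := by
  intro ε hε
  obtain ⟨c, hc, hsub⟩ := N.sublevel_subset_of_mem_nhds (fun _ ↦ hA.1 _)
    (N.Ps_pos_of_mem_equilibria hA) (Metric.ball_mem_nhds A hε)
  obtain ⟨δ, hδ, hball⟩ := Metric.mem_nhds_iff.1 (N.sublevel_mem_nhds (fun _ ↦ hA.1 _) hc)
  refine ⟨δ, hδ, fun T W hW h0 t ht ↦ ?_⟩
  obtain ⟨u, hu0, hu⟩ := exists_isIntegralCurveOn_logField hA (hball h0)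
    (hW.load 0 ⟨le_rfl, ht.1.trans_lt ht.2⟩)
  rw [hW.eqOn_ofLog hu hu0.symm ht]
  exact hsub (ofLog_mem_sublevel_of_le hA hu le_rfl ht.1 (hu0 ▸ hball h0))

theorem exists_forall_tendsto_of_mem_leaf (hA : A ∈ N.equilibria) :
    ∃ δ > 0, ∀ W, N.IsSolution (Ici 0) W → W 0 ∈ N.leaf A → dist (W 0) A < δ →
      Tendsto W atTop (𝓝 A) := by
  obtain ⟨c, hc, hsub⟩ := N.sublevel_subset_of_mem_nhds (fun _ ↦ hA.1 _)
    (N.Ps_pos_of_mem_equilibria hA) (posOrthant_mem_nhds hA.1)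
  obtain ⟨δ, hδ, hball⟩ := Metric.mem_nhds_iff.1 (N.sublevel_mem_nhds (fun _ ↦ hA.1 _) hc)
  refine ⟨δ, hδ, fun W hW hleaf h0 ↦ ?_⟩
  obtain ⟨u, hu0, hu⟩ := exists_isIntegralCurveOn_logField hA (hball h0) (hW.load 0 self_mem_Ici)
  obtain ⟨Ve, hVe, hVeleaf, hlim⟩ := exists_tendsto_ofLog hA hsub hu (hu0 ▸ hball h0)
  rw [hu0] at hVeleaf
  obtain rfl := N.eq_of_mem_equilibria_of_mem_leaf hVe.1 hA (hVeleaf.trans hleaf)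
  refine hlim.congr' ?_
  filter_upwards [eventually_ge_atTop 0] with t ht
  exact ((hW.mono Ico_subset_Ici_self).eqOn_ofLog hu hu0.symm ⟨ht, lt_add_one t⟩).symm

theorem asymptoticallyStable_of_mem_equilibria (hA : A ∈ N.equilibria) :
    N.AsymptoticallyStable A :=
  ⟨N.isEquilibrium_of_mem_equilibria hA, lyapunovStable_of_mem_equilibria hA,
    exists_forall_tendsto_of_mem_leaf hA⟩

end Convergence

end

end Microgrid

theorem theorem2 {S L : Type*} [Fintype S] [Fintype L] [DecidableEq S] [DecidableEq L]
    [Nonempty S] [Nonempty L] (N : Microgrid S L)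
    (Vbar : S ⊕ L → ℝ) (hVbar : Vbar ∈ N.equilibria) :
    (∃ c > 0, IsCompact (N.sublevel Vbar c) ∧
      N.sublevel Vbar c ⊆ Microgrid.posOrthant S L) ∧
    ∀ c : ℝ, N.sublevel Vbar c ⊆ Microgrid.posOrthant S L →
      ∀ V0 ∈ N.sublevel Vbar c, N.LoadBalance V0 →
        ∃ V : ℝ → S ⊕ L → ℝ, N.IsSolution (Ici 0) V ∧ V 0 = V0 ∧
          (∀ (T : ℝ) (W : ℝ → S ⊕ L → ℝ), N.IsSolution (Ico 0 T) W → W 0 = V0 →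
            EqOn W V (Ico 0 T)) ∧
          (∀ t, 0 ≤ t → V t ∈ N.sublevel Vbar c) ∧
          ∃ Ve ∈ N.equilibria ∩ N.sublevel Vbar c ∩ N.preserved (N.sublevel Vbar c) V0,
            N.AsymptoticallyStable Ve ∧ Tendsto V atTop (𝓝 Ve) := by
  constructor
  · have hP := N.Ps_pos_of_mem_equilibria hVbar
    obtain ⟨c, hc, hsub⟩ := N.sublevel_subset_of_mem_nhds (fun _ ↦ hVbar.1 _) hP
      (Microgrid.posOrthant_mem_nhds hVbar.1)
    exact ⟨c, hc, N.isCompact_sublevel (fun _ ↦ hVbar.1 _) hP c, hsub⟩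
  · intro c hc V0 hV0 hbal
    obtain ⟨u, rfl, hu⟩ := Microgrid.exists_isIntegralCurveOn_logField hVbar hV0 hbal
    obtain ⟨Ve, hVe, hleaf, hlim⟩ := Microgrid.exists_tendsto_ofLog hVbar hc hu hV0
    exact ⟨fun t ↦ N.ofLog (u t), Microgrid.isSolution_ofLog hu, rfl,
      fun T W hW hW0 ↦ hW.eqOn_ofLog hu hW0,
      fun t ht ↦ Microgrid.ofLog_mem_sublevel_of_le hVbar hu le_rfl ht hV0,
      Ve, ⟨hVe, hVe.2, hleaf, hVe.1.2.2⟩,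
      Microgrid.asymptoticallyStable_of_mem_equilibria hVe.1, hlim⟩
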